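/- Let $n\ge 1$. For a bounded measurable function $m$ on $\mathbb R^n\times\mathbb R^n$ and Schwartz functions $f,g\in\mathcal S(\mathbb R^n)$ put $$M_m(f,g)(x)=\int_{\mathbb R^n}\int_{\mathbb R^n}\hat f(\xi)\,\hat g(\eta)\,m(\xi,\eta)\,e^{2\pi i x\cdot(\xi+\eta)}\,d\xi\,d\eta ,\qquad \hat f(\xi)=\int_{\mathbb R^n} f(x)e^{-2\pi i x\cdot\xi}\,dx ,$$ and call $m$ a bilinear multiplier for $(p,q,r)$ if there is a constant $C<\infty$ such that $\|M_m(f,g)\|_{L^r}\le C\|f\|_{L^p}\|g\|_{L^q}$ for all $f,g\in\mathcal S(\mathbb R^n)$. The local $L^2$-range is the set of exponent triples $(p,q,r)$ with $2\le p,q,r'\le\infty$ and $\frac1p+\frac1q=\frac1r$, where $\frac1r+\frac1{r'}=1$; in the coordinates $(\frac1p,\frac1q,\frac1r)$ (with $\frac1\infty=0$) it is the closed triangle with vertices $A=(\frac12,0,\frac12)$, $B=(0,\frac12,\frac12)$, $C=(\frac12,\frac12,1)$. Then for every triple $(p,q,r)$ in the local $L^2$-range whose point $(\frac1p,\frac1q,\frac1r)$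 lies on the boundary of this triangle, that is, on one of the closed segments $AC$, $CB$, $BA$ (vertices included), the function $e^{i\xi\cdot\eta}$ is not a bilinear multiplier for $(p,q,r)$. -/

import Mathlib

open MeasureTheory
open scoped ENNReal NNReal FourierTransform SchwartzMap

noncomputable section

/-- The bilinear operator with symbol `m`:
`M_m(f,g)(x) = ∫∫ f^(ξ) g^(η) m(ξ,η) e^{2πi x·(ξ+η)} dξ dη`,
where `f^(ξ) = ∫ f(x) e^{-2πi x·ξ} dx`. -/
def bilinearOp {n : ℕ}
    (m : EuclideanSpace ℝ (Fin n) → EuclideanSpace ℝ (Fin n) → ℂ)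
    (f g : EuclideanSpace ℝ (Fin n) → ℂ) (x : EuclideanSpace ℝ (Fin n)) : ℂ :=
  ∫ ξ : EuclideanSpace ℝ (Fin n), ∫ η : EuclideanSpace ℝ (Fin n),
    𝓕 f ξ * 𝓕 g η * m ξ η *
      Complex.exp (2 * (Real.pi : ℂ) * Complex.I * ((inner ℝ x (ξ + η) : ℝ) : ℂ))

/-- A (bounded measurable) symbol `m` is a bilinear multiplier for `(p,q,r)`: the operator,
initially defined on Schwartz functions, satisfies an `L^p × L^q → L^r` bound with a finite
constant independent of the functions. -/
def IsBilinearMultiplier {n : ℕ}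
    (m : EuclideanSpace ℝ (Fin n) → EuclideanSpace ℝ (Fin n) → ℂ) (p q r : ℝ≥0∞) : Prop :=
  ∃ C : ℝ≥0, ∀ f g : 𝓢(EuclideanSpace ℝ (Fin n), ℂ),
    eLpNorm (bilinearOp m (⇑f) (⇑g)) r volume
      ≤ (C : ℝ≥0∞) * eLpNorm (⇑f) p volume * eLpNorm (⇑g) q volume

/-- The local `L²` range: `2 ≤ p, q, r' ≤ ∞` and `1/p + 1/q = 1/r`, where `r'` is the
conjugate exponent of `r`. -/
def localL2Range : Set (ℝ≥0∞ × ℝ≥0∞ × ℝ≥0∞) :=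
  {t | 2 ≤ t.1 ∧ 2 ≤ t.2.1 ∧ (∃ r' : ℝ≥0∞, t.2.2.HolderConjugate r' ∧ 2 ≤ r') ∧
    t.1⁻¹ + t.2.1⁻¹ = t.2.2⁻¹}

/-- The vertices of the local `L²` triangle, in the coordinates `(1/p, 1/q, 1/r)`. -/
def vertexA : ℝ × ℝ × ℝ := (1 / 2, 0, 1 / 2)

def vertexB : ℝ × ℝ × ℝ := (0, 1 / 2, 1 / 2)

def vertexC : ℝ × ℝ × ℝ := (1 / 2, 1 / 2, 1)

/-- The triples of the local `L²` range whose point `(1/p, 1/q, 1/r)` lies on one of the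
segments `AC`, `CB`, `BA` (with `1/∞ = 0`; the vertices are included). -/
def localL2Boundary : Set (ℝ≥0∞ × ℝ≥0∞ × ℝ≥0∞) :=
  {t | t ∈ localL2Range ∧
    (t.1⁻¹.toReal, t.2.1⁻¹.toReal, t.2.2⁻¹.toReal) ∈
      segment ℝ vertexA vertexC ∪ segment ℝ vertexC vertexB ∪ segment ℝ vertexB vertexA}

/-- The symbol `e^{i ξ·η}`. -/
def expInnerSymbol {n : ℕ} (ξ η : EuclideanSpace ℝ (Fin n)) : ℂ :=
  Complex.exp (Complex.I * ((inner ℝ ξ η : ℝ) : ℂ))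

end

/-! Since `e^{i ξ·η}` translates `g` by `ξ/(2π)`, the operator is `∫ f^(ξ) e^{2πi x·ξ} g(x + ξ/(2π))
dξ`. Take `f = g = exp(-b|x|²)` with `b = δ + 2π² i`. The quadratic phases of `f^` and of the
translated `g` then cancel up to `O(δ)`, and the `ξ`-integral gains a factor of order `δ^{-n/2}`,
while the output decays no faster than `|f|` (`le_norm_bilinearOp_gaussianSchwartz_chirp`). As `|f|`
is a dilated fixed Gaussian, the relation `1/p + 1/q = 1/r` makes the dilation factors of the three
norms cancel. The gain survives, and `δ → 0` rules out any constant. -/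

/-- Polynomials are dominated by the inverse of a Gaussian. -/
theorem exists_one_add_pow_mul_exp_neg_mul_sq_le (m : ℕ) {δ : ℝ} (hδ : 0 < δ) :
    ∃ C : ℝ, ∀ s : ℝ, 0 ≤ s → (1 + s) ^ m * Real.exp (-(δ * s ^ 2)) ≤ C := by
  -- From `y^m / m! ≤ e^y` at `y = 2δ(1+s)`, and `2δ(1+s) - δs² = 3δ - δ(s-1)²`.
  refine ⟨m.factorial / (2 * δ) ^ m * Real.exp (3 * δ), fun s hs ↦ ?_⟩
  have h1 := Real.pow_div_factorial_le_exp (2 * δ * (1 + s)) (by positivity) m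
  have hm : (0 : ℝ) < m.factorial := by positivity
  have h2 : (1 + s) ^ m ≤ m.factorial / (2 * δ) ^ m * Real.exp (2 * δ * (1 + s)) := by
    rw [div_le_iff₀ hm, mul_pow] at h1
    rw [div_mul_eq_mul_div, le_div_iff₀ (by positivity)]
    linarith
  calc (1 + s) ^ m * Real.exp (-(δ * s ^ 2))
      ≤ m.factorial / (2 * δ) ^ m * Real.exp (2 * δ * (1 + s)) * Real.exp (-(δ * s ^ 2)) := by
        gcongr
    _ = m.factorial / (2 * δ) ^ m * Real.exp (2 * δ * (1 + s) + -(δ * s ^ 2)) := by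
        rw [mul_assoc, Real.exp_add]
    _ ≤ _ := by
        gcongr
        nlinarith [mul_nonneg hδ.le (sq_nonneg (s - 1))]

theorem iteratedDeriv_cexp_neg_mul_ofReal (b : ℂ) (i : ℕ) :
    iteratedDeriv i (fun t : ℝ ↦ Complex.exp (-b * t)) =
      fun t : ℝ ↦ (-b) ^ i * Complex.exp (-b * t) := by
  induction i with
  | zero => simp
  | succ i ih =>
    rw [iteratedDeriv_succ, ih]
    ext t
    have h : HasDerivAt (fun t : ℝ ↦ Complex.exp (-b * t)) (Complex.exp (-b * t) * (-b * 1)) t :=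
      (((hasDerivAt_id (t : ℂ)).const_mul (-b)).cexp).comp_ofReal
    rw [(h.const_mul _).deriv]
    ring

/-! ### Complex Gaussians as Schwartz functions -/

section Gaussian

variable {V : Type*} [NormedAddCommGroup V] [InnerProductSpace ℝ V]

theorem norm_cexp_neg_mul_sq_norm {V : Type*} [NormedAddCommGroup V] (b : ℂ) (x : V) :
    ‖Complex.exp (-b * (‖x‖ : ℂ) ^ 2)‖ = Real.exp (-(b.re * ‖x‖ ^ 2)) := by
  rw [Complex.norm_exp, ← Complex.ofReal_pow, Complex.re_mul_ofReal]
  simp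

theorem gaussian_decay {b : ℂ} (hb : 0 < b.re) (k n : ℕ) :
    ∃ C : ℝ, ∀ x : V,
      ‖x‖ ^ k * ‖iteratedFDeriv ℝ n (fun x : V ↦ Complex.exp (-b * (‖x‖ : ℂ) ^ 2)) x‖ ≤ C := by
  obtain ⟨l, D, hD, h⟩ :=
    (Function.hasTemperateGrowth_norm_sq (H := V)).norm_iteratedFDeriv_le_uniform n
  obtain ⟨C, hC⟩ := exists_one_add_pow_mul_exp_neg_mul_sq_le (k + l * n) hb
  refine ⟨n.factorial * (1 + ‖b‖) ^ n * (1 + D) ^ n * C, fun x ↦ ?_⟩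
  have hcomp : (fun x : V ↦ Complex.exp (-b * (‖x‖ : ℂ) ^ 2)) =
      (fun t : ℝ ↦ Complex.exp (-b * t)) ∘ fun x : V ↦ ‖x‖ ^ 2 := by
    ext y; simp
  have hg : ContDiff ℝ ⊤ (fun t : ℝ ↦ Complex.exp (-b * t)) :=
    (contDiff_const.mul Complex.ofRealCLM.contDiff).cexp
  -- The inner derivatives must be bounded by `D ^ i`. Using `1 + D` makes the base at least `1`, so
  -- a bound by the base itself suffices for `i ≥ 1`.
  have key := norm_iteratedFDeriv_comp_le (n := n) (N := ⊤) hg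
    (contDiff_norm_sq ℝ (E := V) (n := ⊤)) le_top x
    (C := (1 + ‖b‖) ^ n * Real.exp (-(b.re * ‖x‖ ^ 2))) (D := (1 + D) * (1 + ‖x‖) ^ l)
    (fun i hi ↦ ?_) (fun i hi hi' ↦ ?_)
  · rw [hcomp]
    calc _ ≤ (1 + ‖x‖) ^ k * (n.factorial * ((1 + ‖b‖) ^ n * Real.exp (-(b.re * ‖x‖ ^ 2))) *
            ((1 + D) * (1 + ‖x‖) ^ l) ^ n) := by
          gcongr
          linarith
      _ = n.factorial * (1 + ‖b‖) ^ n * (1 + D) ^ n *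
            ((1 + ‖x‖) ^ (k + l * n) * Real.exp (-(b.re * ‖x‖ ^ 2))) := by
          rw [mul_pow, pow_add, pow_mul]; ring
      _ ≤ _ := by
          gcongr
          exact hC _ (norm_nonneg x)
  · rw [norm_iteratedFDeriv_eq_norm_iteratedDeriv, iteratedDeriv_cexp_neg_mul_ofReal, norm_mul,
      norm_pow, norm_neg, Complex.ofReal_pow, norm_cexp_neg_mul_sq_norm]
    gcongr
    calc ‖b‖ ^ i ≤ (1 + ‖b‖) ^ i := by gcongr; linarith
      _ ≤ _ := pow_le_pow_right₀ (by linarith [norm_nonneg b]) hi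
  · calc _ ≤ D * (1 + ‖x‖) ^ l := h i hi' x
      _ ≤ (1 + D) * (1 + ‖x‖) ^ l := by gcongr; linarith
      _ ≤ _ := le_self_pow₀ (one_le_mul_of_one_le_of_one_le (by linarith)
          (one_le_pow₀ (by linarith [norm_nonneg x]))) (by omega)

/-- The Gaussian `x ↦ exp (-b ‖x‖²)`, with `0 < re b`, as a Schwartz function. -/
noncomputable def gaussianSchwartz (V : Type*) [NormedAddCommGroup V] [InnerProductSpace ℝ V]
    (b : ℂ) (hb : 0 < b.re) : 𝓢(V, ℂ) where
  toFun x := Complex.exp (-b * (‖x‖ : ℂ) ^ 2)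
  smooth' := by
    have h : ContDiff ℝ ⊤ fun x : V ↦ (((‖x‖ ^ 2 : ℝ)) : ℂ) :=
      Complex.ofRealCLM.contDiff.comp (contDiff_norm_sq ℝ)
    simp only [Complex.ofReal_pow] at h
    exact (contDiff_const.mul (h.of_le le_top)).cexp
  decay' := gaussian_decay hb

theorem gaussianSchwartz_apply {b : ℂ} (hb : 0 < b.re) (x : V) :
    gaussianSchwartz V b hb x = Complex.exp (-b * (‖x‖ : ℂ) ^ 2) := rfl

/-- Scaling of the `L^p` norm of a Gaussian. -/
theorem eLpNorm_gaussianSchwartz [FiniteDimensional ℝ V] [MeasurableSpace V] [BorelSpace V]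
    {b : ℂ} (hb : 0 < b.re) (p : ℝ≥0∞) :
    eLpNorm (gaussianSchwartz V b hb) p volume =
      ENNReal.ofReal ((√b.re ^ Module.finrank ℝ V)⁻¹) ^ p⁻¹.toReal *
        eLpNorm (fun x : V ↦ Real.exp (-‖x‖ ^ 2)) p volume := by
  have hs : 0 < √b.re := Real.sqrt_pos.2 hb
  have h1 : eLpNorm (gaussianSchwartz V b hb) p volume =
      eLpNorm ((fun x : V ↦ Real.exp (-‖x‖ ^ 2)) ∘ fun x ↦ √b.re • x) p volume := by
    refine eLpNorm_congr_norm_ae (Filter.Eventually.of_forall fun x ↦ ?_)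
    rw [gaussianSchwartz_apply, norm_cexp_neg_mul_sq_norm, Function.comp_apply,
      Real.norm_of_nonneg (Real.exp_pos _).le, norm_smul, mul_pow, Real.norm_of_nonneg hs.le,
      Real.sq_sqrt hb.le]
  have hc : Continuous fun x : V ↦ Real.exp (-‖x‖ ^ 2) := by fun_prop
  rw [h1, ← eLpNorm_map_measure hc.aestronglyMeasurable (by fun_prop),
    Measure.map_addHaar_smul _ hs.ne', eLpNorm_smul_measure_of_ne_zero, smul_eq_mul,
    abs_of_pos (by positivity)]
  · simp
  · rw [ne_eq, ENNReal.ofReal_eq_zero, not_le]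
    positivity

end Gaussian

/-! ### The operator on Gaussians -/

theorem SchwartzMap.fourierInv_fourier_coe {V : Type*} [NormedAddCommGroup V]
    [InnerProductSpace ℝ V] [FiniteDimensional ℝ V] [MeasurableSpace V] [BorelSpace V]
    (f : 𝓢(V, ℂ)) : 𝓕⁻ (𝓕 (f : V → ℂ)) = f := by
  refine f.continuous.fourierInv_fourier_eq f.integrable ?_
  rw [← SchwartzMap.fourier_coe]
  exact (𝓕 f).integrable

/-- The operator with symbol `e^{i ξ·η}` as a single integral. -/
theorem bilinearOp_expInnerSymbol {n : ℕ} (f g : 𝓢(EuclideanSpace ℝ (Fin n), ℂ))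
    (x : EuclideanSpace ℝ (Fin n)) :
    bilinearOp expInnerSymbol f g x =
      ∫ ξ, 𝓕 (f : EuclideanSpace ℝ (Fin n) → ℂ) ξ *
        Complex.exp (2 * (Real.pi : ℂ) * Complex.I * ((inner ℝ x ξ : ℝ) : ℂ)) *
          g (x + (2 * Real.pi)⁻¹ • ξ) := by
  unfold bilinearOp
  congr 1 with ξ
  -- The `η`-integral is Fourier inversion for `g` at the point `x + ξ/(2π)`.
  rw [← congrFun g.fourierInv_fourier_coe, Real.fourierInv_eq', ← integral_const_mul]
  congr 1 with η
  rw [expInnerSymbol, smul_eq_mul]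
  have : Complex.exp (Complex.I * ((inner ℝ ξ η : ℝ) : ℂ)) *
      Complex.exp (2 * (Real.pi : ℂ) * Complex.I * ((inner ℝ x (ξ + η) : ℝ) : ℂ)) =
      Complex.exp (2 * (Real.pi : ℂ) * Complex.I * ((inner ℝ x ξ : ℝ) : ℂ)) *
      Complex.exp (((2 * Real.pi * inner ℝ η (x + (2 * Real.pi)⁻¹ • ξ) : ℝ) : ℂ) *
        Complex.I) := by
    rw [← Complex.exp_add, ← Complex.exp_add, inner_add_right, inner_add_right,
      real_inner_smul_right, real_inner_comm ξ η, real_inner_comm x η]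
    congr 1
    have := Real.pi_ne_zero
    push_cast
    field_simp
    ring
  linear_combination (𝓕 (f : EuclideanSpace ℝ (Fin n) → ℂ) ξ *
    𝓕 (g : EuclideanSpace ℝ (Fin n) → ℂ) η) * this

/-- The operator with symbol `e^{i ξ·η}` applied to two equal Gaussians. -/
theorem bilinearOp_expInnerSymbol_gaussianSchwartz {n : ℕ} {b : ℂ} (hb : 0 < b.re)
    (hB : 0 < (Real.pi ^ 2 / b + b / (4 * Real.pi ^ 2) : ℂ).re)
    (x : EuclideanSpace ℝ (Fin n)) :
    bilinearOp expInnerSymbol (gaussianSchwartz _ b hb) (gaussianSchwartz _ b hb) x =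
      (Real.pi / b) ^ (n / 2 : ℂ) *
        (Real.pi / (Real.pi ^ 2 / b + b / (4 * Real.pi ^ 2))) ^ (n / 2 : ℂ) *
        Complex.exp ((-b + (2 * Real.pi * Complex.I - b / Real.pi) ^ 2 /
          (4 * (Real.pi ^ 2 / b + b / (4 * Real.pi ^ 2)))) * (‖x‖ : ℂ) ^ 2) := by
  -- `-B` and `c` are the coefficients of `|ξ|²` and `x·ξ` in the exponent of the single integral.
  set B : ℂ := Real.pi ^ 2 / b + b / (4 * Real.pi ^ 2) with hBdef
  set c : ℂ := 2 * Real.pi * Complex.I - b / Real.pi with hc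
  have hb0 : b ≠ 0 := by rintro rfl; simp at hb
  have hpi : (Real.pi : ℂ) ≠ 0 := by exact_mod_cast Real.pi_ne_zero
  have hG := GaussianFourier.integral_cexp_neg_mul_sq_norm_add hB c x
  rw [finrank_euclideanSpace_fin] at hG
  have hF (ξ : EuclideanSpace ℝ (Fin n)) :
      𝓕 (gaussianSchwartz (EuclideanSpace ℝ (Fin n)) b hb : _ → ℂ) ξ =
        (Real.pi / b) ^ (n / 2 : ℂ) * Complex.exp (-Real.pi ^ 2 * ‖ξ‖ ^ 2 / b) := by
    have := fourier_gaussian_innerProductSpace hb ξ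
    rwa [finrank_euclideanSpace_fin] at this
  have hsq (ξ : EuclideanSpace ℝ (Fin n)) : ((‖x + (2 * Real.pi)⁻¹ • ξ‖ : ℝ) : ℂ) ^ 2 =
      (‖x‖ : ℂ) ^ 2 + (inner ℝ x ξ : ℝ) / Real.pi + (‖ξ‖ : ℂ) ^ 2 / (4 * Real.pi ^ 2) := by
    have := norm_add_sq_real x ((2 * Real.pi)⁻¹ • ξ)
    rw [real_inner_smul_right, norm_smul, mul_pow, Real.norm_eq_abs, sq_abs] at this
    rw [← Complex.ofReal_pow, this]
    push_cast
    field_simp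
    ring
  rw [bilinearOp_expInnerSymbol]
  calc _ = ∫ ξ : EuclideanSpace ℝ (Fin n), (Real.pi / b : ℂ) ^ (n / 2 : ℂ) *
        Complex.exp (-b * (‖x‖ : ℂ) ^ 2) *
          Complex.exp (-B * (‖ξ‖ : ℂ) ^ 2 + c * (inner ℝ x ξ : ℝ)) := by
        congr 1 with ξ
        rw [hF, gaussianSchwartz_apply, hsq]
        simp only [mul_assoc (_ ^ (n / 2 : ℂ)), ← Complex.exp_add]
        rw [hBdef, hc]
        congr 2
        field_simp
        ring
    _ = _ := by
        rw [integral_const_mul, hG, add_mul, Complex.exp_add]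
        rw [show c ^ 2 / (4 * B) * (‖x‖ : ℂ) ^ 2 = c ^ 2 * (‖x‖ : ℂ) ^ 2 / (4 * B) by ring]
        ring

/-! ### Lower bound on chirped Gaussians -/

/-- The chirp parameter `δ + 2π² i`. -/
noncomputable def chirp (δ : ℝ) : ℂ := ⟨δ, 2 * Real.pi ^ 2⟩

theorem chirp_eq (δ : ℝ) : chirp δ = δ + 2 * Real.pi ^ 2 * Complex.I := by
  rw [chirp, Complex.mk_eq_add_mul_I]
  push_cast
  rfl

/-- The imaginary part `2π²` is chosen so that `4π⁴ + b²` loses its constant term, leaving a factor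
`δ`. -/
theorem chirp_add_inv (δ : ℝ) (hδ : 0 < δ) :
    (Real.pi ^ 2 / chirp δ + chirp δ / (4 * Real.pi ^ 2) : ℂ) =
      δ * (δ + 4 * Real.pi ^ 2 * Complex.I) / (4 * Real.pi ^ 2 * chirp δ) := by
  have hb0 : chirp δ ≠ 0 := fun h ↦ hδ.ne' (by simpa [chirp] using congrArg Complex.re h)
  have hpi : (Real.pi : ℂ) ≠ 0 := by exact_mod_cast Real.pi_ne_zero
  field_simp
  rw [chirp_eq]
  linear_combination (4 * (Real.pi : ℂ) ^ 4) * Complex.I_sq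

theorem re_chirp_add_inv_pos (δ : ℝ) (hδ : 0 < δ) :
    0 < (Real.pi ^ 2 / chirp δ + chirp δ / (4 * Real.pi ^ 2) : ℂ).re := by
  have h1 : (Real.pi ^ 2 / chirp δ : ℂ) = ((Real.pi ^ 2 : ℝ) : ℂ) * (chirp δ)⁻¹ := by
    push_cast; rfl
  have h2 : (chirp δ / (4 * Real.pi ^ 2) : ℂ) = (((4 * Real.pi ^ 2)⁻¹ : ℝ) : ℂ) * chirp δ := by
    push_cast; ring
  have hb0 : chirp δ ≠ 0 := fun h ↦ hδ.ne' (by simpa [chirp] using congrArg Complex.re h)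
  have hre : (chirp δ).re = δ := rfl
  have hN := Complex.normSq_pos.2 hb0
  rw [h1, h2, Complex.add_re, Complex.re_ofReal_mul, Complex.re_ofReal_mul, Complex.inv_re, hre]
  have := Real.pi_pos
  positivity

/-- The operator with symbol `e^{i ξ·η}` gains a factor `δ ^ (-n / 2)` on chirped Gaussians. -/
theorem le_norm_bilinearOp_gaussianSchwartz_chirp {n : ℕ} {δ : ℝ} (hδ : 0 < δ) (hδ1 : δ ≤ 1)
    (x : EuclideanSpace ℝ (Fin n)) :
    (2 * δ)⁻¹ ^ (n / 2 : ℝ) * Real.exp (-(δ * ‖x‖ ^ 2)) ≤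
      ‖bilinearOp expInnerSymbol (gaussianSchwartz _ (chirp δ) hδ)
        (gaussianSchwartz _ (chirp δ) hδ) x‖ := by
  have hb : 0 < (chirp δ).re := hδ
  have hB := re_chirp_add_inv_pos δ hδ
  rw [bilinearOp_expInnerSymbol_gaussianSchwartz hb hB]
  have hB' := chirp_add_inv δ hδ
  set B : ℂ := Real.pi ^ 2 / chirp δ + chirp δ / (4 * Real.pi ^ 2) with hBdef
  have hpi := Real.pi_pos
  have hpi' : (Real.pi : ℂ) ≠ 0 := by exact_mod_cast Real.pi_ne_zero
  have hb0 : chirp δ ≠ 0 := fun h ↦ hδ.ne' (by simpa [chirp] using congrArg Complex.re h)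
  have hc : (2 * Real.pi * Complex.I - chirp δ / Real.pi : ℂ) = ((-(δ / Real.pi) : ℝ) : ℂ) := by
    rw [chirp_eq]
    push_cast
    field_simp
    ring
  -- The linear coefficient is the real number `-δ/π`, so completing the square adds a term of
  -- nonnegative real part to `-b`.
  have hexp : Real.exp (-(δ * ‖x‖ ^ 2)) ≤ ‖Complex.exp ((-chirp δ +
      (2 * Real.pi * Complex.I - chirp δ / Real.pi) ^ 2 / (4 * B)) * (‖x‖ : ℂ) ^ 2)‖ := by
    rw [Complex.norm_exp, hc, ← Complex.ofReal_pow, ← Complex.ofReal_pow, Complex.re_mul_ofReal,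
      Real.exp_le_exp, ← neg_mul]
    gcongr
    have : (((-(δ / Real.pi)) ^ 2 : ℝ) : ℂ) / (4 * B) =
        (((-(δ / Real.pi)) ^ 2 / 4 : ℝ) : ℂ) * B⁻¹ := by
      push_cast; field_simp
    rw [this, Complex.add_re, Complex.re_ofReal_mul, Complex.inv_re, Complex.neg_re]
    have hre : (chirp δ).re = δ := rfl
    have : 0 ≤ (-(δ / Real.pi)) ^ 2 / 4 * (B.re / Complex.normSq B) := by
      have := Complex.normSq_nonneg B
      positivity
    linarith
  rw [norm_mul, norm_mul]
  gcongr
  rw [show (n / 2 : ℂ) = ((n / 2 : ℝ) : ℂ) by push_cast; rfl, Complex.norm_cpow_real,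
    Complex.norm_cpow_real, ← Real.mul_rpow (norm_nonneg _) (norm_nonneg _), ← norm_mul]
  have hw : ‖(δ + 4 * Real.pi ^ 2 * Complex.I : ℂ)‖ ≤ 8 * Real.pi ^ 2 := by
    refine (norm_add_le _ _).trans ?_
    simp only [norm_mul, norm_pow, Complex.norm_I, Complex.norm_real, Real.norm_eq_abs,
      abs_of_pos hδ, abs_of_pos hpi, RCLike.norm_ofNat]
    nlinarith [Real.pi_gt_three]
  have hw0 : (δ + 4 * Real.pi ^ 2 * Complex.I : ℂ) ≠ 0 := fun h ↦ hδ.ne' (by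
    have := congrArg Complex.re h
    simpa [← Complex.ofReal_pow] using this)
  -- With `hw`, this product has modulus at least `π²/(2δ)`, hence at least `1/(2δ)`.
  have hprod : (Real.pi / chirp δ * (Real.pi / B) : ℂ) =
      ((4 * Real.pi ^ 4 / δ : ℝ) : ℂ) / (δ + 4 * Real.pi ^ 2 * Complex.I) := by
    have : (δ : ℂ) ≠ 0 := by exact_mod_cast hδ.ne'
    rw [hB']
    push_cast
    field_simp
  rw [hprod, norm_div, Complex.norm_real, Real.norm_of_nonneg (by positivity)]
  gcongr
  rw [inv_eq_one_div, div_le_div_iff₀ (by positivity) (norm_pos_iff.2 hw0)]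
  have h8 : 4 * Real.pi ^ 4 / δ * (2 * δ) = 8 * Real.pi ^ 4 := by field_simp; norm_num
  rw [h8]
  have h4 : Real.pi ^ 2 ≤ Real.pi ^ 4 :=
    pow_le_pow_right₀ (by linarith [Real.pi_gt_three]) (by norm_num)
  linarith

/-! ### Scaling and contradiction -/

/-- Boundedness on chirped Gaussians forces a bound uniform in `δ`, for every Hölder triple. -/
theorem IsBilinearMultiplier.ofReal_rpow_mul_eLpNorm_le {n : ℕ} {p q r : ℝ≥0∞}
    (hp : p ≠ 0) (hq : q ≠ 0) (hpqr : p⁻¹ + q⁻¹ = r⁻¹) {C : ℝ≥0}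
    (hC : ∀ f g : 𝓢(EuclideanSpace ℝ (Fin n), ℂ),
      eLpNorm (bilinearOp expInnerSymbol f g) r volume ≤
        C * eLpNorm f p volume * eLpNorm g q volume)
    {δ : ℝ} (hδ : 0 < δ) (hδ1 : δ ≤ 1) :
    ENNReal.ofReal ((2 * δ)⁻¹ ^ (n / 2 : ℝ)) *
        eLpNorm (fun x : EuclideanSpace ℝ (Fin n) ↦ Real.exp (-‖x‖ ^ 2)) r volume ≤
      C * eLpNorm (fun x : EuclideanSpace ℝ (Fin n) ↦ Real.exp (-‖x‖ ^ 2)) p volume *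
        eLpNorm (fun x : EuclideanSpace ℝ (Fin n) ↦ Real.exp (-‖x‖ ^ 2)) q volume := by
  have hb : 0 < (chirp δ).re := hδ
  set f := gaussianSchwartz (EuclideanSpace ℝ (Fin n)) (chirp δ) hb with hf
  set K : ℝ := (2 * δ)⁻¹ ^ (n / 2 : ℝ) with hK
  have hK0 : 0 ≤ K := by positivity
  have hlow : ENNReal.ofReal K * eLpNorm f r volume ≤
      C * eLpNorm f p volume * eLpNorm f q volume := by
    refine le_trans ?_ (hC f f)
    rw [← Real.enorm_eq_ofReal hK0, ← eLpNorm_norm f, ← eLpNorm_const_smul]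
    refine eLpNorm_mono fun x ↦ ?_
    rw [Pi.smul_apply, norm_smul, norm_norm, Real.norm_of_nonneg hK0, hf, gaussianSchwartz_apply,
      norm_cexp_neg_mul_sq_norm]
    exact le_norm_bilinearOp_gaussianSchwartz_chirp hδ hδ1 x
  simp only [hf, eLpNorm_gaussianSchwartz] at hlow
  set S : ℝ≥0∞ := ENNReal.ofReal
    ((√(chirp δ).re ^ Module.finrank ℝ (EuclideanSpace ℝ (Fin n)))⁻¹) with hS
  have hS0 : S ≠ 0 := by
    rw [hS, ne_eq, ENNReal.ofReal_eq_zero, not_le]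
    have := Real.sqrt_pos.2 hb
    positivity
  -- Under the Hölder relation the dilation factors on the two sides agree and can be divided out.
  have hSr : S ^ r⁻¹.toReal = S ^ p⁻¹.toReal * S ^ q⁻¹.toReal := by
    rw [← ENNReal.rpow_add _ _ hS0 ENNReal.ofReal_ne_top, ← hpqr,
      ENNReal.toReal_add (ENNReal.inv_ne_top.2 hp) (ENNReal.inv_ne_top.2 hq)]
  have hSr0 : S ^ r⁻¹.toReal ≠ 0 :=
    (ENNReal.rpow_pos (pos_iff_ne_zero.2 hS0) ENNReal.ofReal_ne_top).ne'
  have hSrt : S ^ r⁻¹.toReal ≠ ∞ :=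
    ENNReal.rpow_ne_top_of_nonneg ENNReal.toReal_nonneg ENNReal.ofReal_ne_top
  rw [← ENNReal.mul_le_mul_iff_right hSr0 hSrt]
  refine le_trans (le_of_eq (by ring)) (hlow.trans (le_of_eq ?_))
  rw [hSr]
  ring

theorem eLpNorm_exp_neg_sq_norm_ne_top {n : ℕ} (p : ℝ≥0∞) :
    eLpNorm (fun x : EuclideanSpace ℝ (Fin n) ↦ Real.exp (-‖x‖ ^ 2)) p volume ≠ ∞ := by
  have h1 : 0 < (1 : ℂ).re := by simp
  set f := gaussianSchwartz (EuclideanSpace ℝ (Fin n)) 1 h1 with hf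
  have h : eLpNorm (fun x : EuclideanSpace ℝ (Fin n) ↦ Real.exp (-‖x‖ ^ 2)) p volume =
      eLpNorm f p volume := by
    refine eLpNorm_congr_norm_ae (Filter.Eventually.of_forall fun x ↦ ?_)
    rw [hf, gaussianSchwartz_apply, norm_cexp_neg_mul_sq_norm,
      Real.norm_of_nonneg (Real.exp_pos _).le, Complex.one_re, one_mul]
  rw [h]
  exact (f.memLp p volume).eLpNorm_ne_top

theorem eLpNorm_exp_neg_sq_norm_ne_zero {n : ℕ} {p : ℝ≥0∞} (hp : p ≠ 0) :
    eLpNorm (fun x : EuclideanSpace ℝ (Fin n) ↦ Real.exp (-‖x‖ ^ 2)) p volume ≠ 0 := by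
  have hc : Continuous fun x : EuclideanSpace ℝ (Fin n) ↦ Real.exp (-‖x‖ ^ 2) := by fun_prop
  rw [ne_eq, eLpNorm_eq_zero_iff hc.aestronglyMeasurable hp,
    Continuous.ae_eq_iff_eq volume hc continuous_zero]
  exact fun h ↦ (Real.exp_pos _).ne' (congrFun h 0)

/-- The symbol `e^{i ξ·η}` is not a bilinear multiplier for any Hölder triple. -/
theorem not_isBilinearMultiplier_expInnerSymbol {n : ℕ} (hn : 1 ≤ n) {p q r : ℝ≥0∞}
    (hp : p ≠ 0) (hq : q ≠ 0) (hpqr : p⁻¹ + q⁻¹ = r⁻¹) :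
    ¬ IsBilinearMultiplier
        (expInnerSymbol : EuclideanSpace ℝ (Fin n) → EuclideanSpace ℝ (Fin n) → ℂ) p q r := by
  rintro ⟨C, hC⟩
  have hr : r ≠ 0 := by
    rintro rfl
    simp [hp, hq] at hpqr
  set A : ℝ≥0∞ → ℝ≥0∞ := fun s ↦
    eLpNorm (fun x : EuclideanSpace ℝ (Fin n) ↦ Real.exp (-‖x‖ ^ 2)) s volume
  have hA0 : A r ≠ 0 := eLpNorm_exp_neg_sq_norm_ne_zero hr
  have hAt (s) : A s ≠ ∞ := eLpNorm_exp_neg_sq_norm_ne_top s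
  set T : ℝ≥0∞ := C * A p * A q / A r with hTdef
  have hT : T ≠ ∞ := ENNReal.div_ne_top
    (ENNReal.mul_ne_top (ENNReal.mul_ne_top ENNReal.coe_ne_top (hAt p)) (hAt q)) hA0
  -- With `δ = 1/(2L²)` the gain is exactly `L ^ n ≥ L > T`, contradicting the uniform bound by `T`.
  set L : ℝ := 1 + T.toReal
  have hL : 1 ≤ L := by simp [L]
  have hL0 : 0 < L := by linarith
  have hδ : (0 : ℝ) < (2 * L ^ 2)⁻¹ := by positivity
  have hδ1 : (2 * L ^ 2)⁻¹ ≤ 1 := inv_le_one_of_one_le₀ (by nlinarith)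
  have h := IsBilinearMultiplier.ofReal_rpow_mul_eLpNorm_le hp hq hpqr hC hδ hδ1
  have h2 : (2 * (2 * L ^ 2)⁻¹)⁻¹ = L ^ (2 : ℝ) := by
    rw [Real.rpow_two]; field_simp
  rw [h2, ← Real.rpow_mul hL0.le, mul_div_cancel₀ _ two_ne_zero, Real.rpow_natCast,
    ← ENNReal.le_div_iff_mul_le (Or.inl hA0) (Or.inl (hAt r))] at h
  have h3 : L ^ n ≤ T.toReal := (ENNReal.ofReal_le_iff_le_toReal hT).1 h
  have h4 : L ≤ L ^ n := le_self_pow₀ hL (by omega)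
  simp only [L] at h3 h4
  linarith

theorem mainTheorem6 (n : ℕ) (hn : 1 ≤ n) (p q r : ENNReal)
    (hpqr : (p, q, r) ∈ localL2Boundary) :
    ¬ IsBilinearMultiplier
        (expInnerSymbol : EuclideanSpace ℝ (Fin n) → EuclideanSpace ℝ (Fin n) → ℂ) p q r := by
  obtain ⟨⟨hp, hq, -, h⟩, -⟩ := hpqr
  exact not_isBilinearMultiplier_expInnerSymbol hn (two_pos.trans_le hp).ne'
    (two_pos.trans_le hq).ne' h
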